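/- Let $a,b$ be integers with $b\ge 2$ and $1\le a\le b-1$. Define words over $\{0,1\}$ by $B_0=0$ and $$B_{k+1}=(B_k)^{a b^k}\,1\,(B_k)^{(b-a)b^k}\qquad(k\ge 0),$$ let $X\subset\{0,1\}^{\mathbb Z}$ be the set of two-sided sequences all of whose finite words are consecutive subwords of some $B_k$, let $T$ be the left shift on $X$, and let $\mu$ be the shift-invariant Borel probability measure on $X$ that gives every cylinder set $\{x\in X: x_jx_{j+1}\cdots x_{j+l-1}=w\}$ the mass $\lim_{k\to\infty}d_k(w)$, where $d_k(w)$ is the density of the occurrences of $w$ in the periodic sequence $\cdots B_kB_kB_k\cdots$. The system $(X,\mu,T)$ is the generalized del Junco–Rudolph map with parameters $a,b$. Let $\mathrm{Aut}(X,\mu)$ be the group of invertible bimeasurable $\mu$-preserving transformations of $X$ modulo almost everywhere equality, with the weak topology: $S_n\to S$ if and only if $\mu(S_nA\,\triangle\,SA)\to0$ for every measurable $A$. The weak closure $\mathrm{WC}(T)$ of $T$ is the closure of $\{T^n:n\in\mathbb Z\}$ in $\mathrm{Aut}(X,\mu)$. A transformation $S\in\mathrm{Aut}(X,\mu)$ is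 rank one if for every finite measurable partition $P$ of $X$ and every $\varepsilon>0$ there are a measurable set $F$ and an integer $h\ge1$ such that $F,SF,\dots,S^{h-1}F$ are pairwise disjoint and cover $X$ up to a set of measure less than $\varepsilon$, and there is a partition $P'$, coarser than the partition of $X$ into $F,SF,\dots,S^{h-1}F$ and the remaining set, that differs from $P$ only on a set of measure less than $\varepsilon$. Then, for all such $a,b$, there is a dense $G_\delta$ subset of $\mathrm{WC}(T)$ (in the subspace topology) all of whose elements are rank one transformations. -/

import Mathlib

namespace DJR

open MeasureTheory Filter Topology Set
open scoped ENNReal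

/-- `B_0 = 0`, `B_{k+1} = (B_k)^{a b^k} 1 (B_k)^{(b-a) b^k}`. -/
def block (a b : ℕ) : ℕ → List (Fin 2)
  | 0 => [0]
  | k + 1 => (List.replicate (a * b ^ k) (block a b k)).flatten ++ [1] ++
      (List.replicate ((b - a) * b ^ k) (block a b k)).flatten

/-- The phase space: the two-sided sequences all of whose finite words occur as consecutive
subwords of some `B_k`. -/
def shiftSpace (a b : ℕ) : Set (ℤ → Fin 2) :=
  {x | ∀ (m : ℤ) (l : ℕ), ∃ k, (List.ofFn fun i : Fin l => x (m + i)) <:+: block a b k}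

/-- The word `w` occurs in `x` at position `j`. -/
def Occurs {l : ℕ} (w : Fin l → Fin 2) (x : ℤ → Fin 2) (j : ℤ) : Prop :=
  ∀ i : Fin l, x (j + i) = w i

/-- The periodic sequence `⋯ B_k B_k B_k ⋯`. -/
def periodicSeq (a b k : ℕ) (n : ℤ) : Fin 2 :=
  (block a b k).getD (n % ((block a b k).length : ℤ)).toNat 0

instance {l : ℕ} (w : Fin l → Fin 2) (x : ℤ → Fin 2) (j : ℤ) : Decidable (Occurs w x j) :=
  inferInstanceAs (Decidable (∀ i : Fin l, x (j + i) = w i))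

/-- `d_k(w)`: the density of the occurrences of the word `w` in `⋯ B_k B_k B_k ⋯`. That sequence has
period `h_k = |B_k|`, so the density is the proportion of occurrences within one period. -/
noncomputable def density (a b k : ℕ) {l : ℕ} (w : Fin l → Fin 2) : ℝ :=
  (((Finset.range (block a b k).length).filter
      fun i : ℕ => Occurs w (periodicSeq a b k) i).card : ℝ) / ((block a b k).length : ℝ)

theorem length_flatten_replicate (m : ℕ) (L : List (Fin 2)) :
    (List.replicate m L).flatten.length = m * L.length := by
  induction m with
  | zero => simp
  | succ m ih => simp

theorem length_succ {a b : ℕ} (hab : a < b) (k : ℕ) :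
    (block a b (k + 1)).length = b ^ (k + 1) * (block a b k).length + 1 := by
  obtain ⟨c, rfl⟩ := Nat.exists_eq_add_of_lt hab
  simp only [block, List.length_append, length_flatten_replicate, List.length_singleton]
  rw [show a + c + 1 - a = c + 1 by omega]
  ring

theorem length_pos (a b k : ℕ) : 0 < (block a b k).length := by
  cases k with
  | zero => simp [block]
  | succ k => simp [block]

theorem length_ge {a b : ℕ} (ha : 1 ≤ a) (hab : a < b) (k : ℕ) :
    2 ^ k ≤ (block a b k).length := by
  induction k with
  | zero => simp [block]
  | succ k ih =>
    rw [length_succ hab, pow_succ]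
    have h1 : 2 ≤ b ^ (k + 1) := by
      calc 2 ≤ b := by omega
        _ ≤ b ^ (k + 1) := Nat.le_self_pow (by omega) b
    nlinarith

theorem getD_flatten_replicate (L : List (Fin 2)) (m i : ℕ) (hi : i < m * L.length) :
    (List.replicate m L).flatten.getD i 0 = L.getD (i % L.length) 0 := by
  induction m generalizing i with
  | zero => simp at hi
  | succ m ih =>
    rw [List.replicate_succ, List.flatten_cons]
    by_cases h : i < L.length
    · rw [List.getD_append _ _ _ _ h, Nat.mod_eq_of_lt h]
    · push Not at h
      rw [List.getD_append_right _ _ _ _ h, ih]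
      · rw [← Nat.mod_eq_sub_mod h]
      · rw [Nat.succ_mul] at hi; omega

theorem periodicSeq_natCast (a b k n : ℕ) :
    periodicSeq a b k n = (block a b k).getD (n % (block a b k).length) 0 := by
  unfold periodicSeq
  congr 1

theorem periodicSeq_add (a b k : ℕ) (n : ℤ) :
    periodicSeq a b k (n + (block a b k).length) = periodicSeq a b k n := by
  simp [periodicSeq]

theorem occurs_periodic (a b k : ℕ) {l : ℕ} (w : Fin l → Fin 2) :
    Function.Periodic (Occurs w (periodicSeq a b k)) ((block a b k).length : ℤ) := by
  intro n
  simp only [Occurs, eq_iff_iff]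
  refine forall_congr' fun i => ?_
  rw [add_right_comm, periodicSeq_add]

/-- first part of the next block -/
theorem periodicSeq_succ_left {a b : ℕ} (k i : ℕ)
    (hi : i < a * b ^ k * (block a b k).length) :
    periodicSeq a b (k + 1) i = periodicSeq a b k i := by
  have hl : i < (block a b (k + 1)).length := by
    simp only [block, List.length_append, length_flatten_replicate]; omega
  rw [periodicSeq_natCast, periodicSeq_natCast, Nat.mod_eq_of_lt hl, block, List.append_assoc,
    List.getD_append _ _ _ _ (by rwa [length_flatten_replicate]), getD_flatten_replicate _ _ _ hi]

theorem periodicSeq_succ_right {a b : ℕ} (k i : ℕ)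
    (hi : i < (b - a) * b ^ k * (block a b k).length) :
    periodicSeq a b (k + 1) ((a * b ^ k * (block a b k).length + 1 + i : ℕ) : ℤ) =
      periodicSeq a b k i := by
  have hl : a * b ^ k * (block a b k).length + 1 + i < (block a b (k + 1)).length := by
    simp only [block, List.length_append, length_flatten_replicate, List.length_singleton]; omega
  rw [periodicSeq_natCast, periodicSeq_natCast, Nat.mod_eq_of_lt hl, block,
    List.getD_append_right]
  · rw [← getD_flatten_replicate _ _ _ hi]
    congr 1
    simp only [List.length_append, length_flatten_replicate, List.length_singleton]; omega
  · simp only [List.length_append, length_flatten_replicate, List.length_singleton]; omega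

theorem sum_periodic_int {H : ℕ} (f : ℤ → ℝ) (hf : Function.Periodic f H) (j : ℤ) :
    ∑ i ∈ Finset.range H, f (i + j) = ∑ i ∈ Finset.range H, f i := by
  have key : ∀ j : ℤ, ∑ i ∈ Finset.range H, f (i + (j + 1)) = ∑ i ∈ Finset.range H, f (i + j) := by
    intro j
    have h1 := Finset.sum_range_succ (fun i : ℕ => f (i + j)) H
    have h2 := Finset.sum_range_succ' (fun i : ℕ => f (i + j)) H
    have h3 : f ((H : ℤ) + j) = f (((0 : ℕ) : ℤ) + j) := by
      rw [add_comm (H : ℤ) j, hf]; simp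
    have h4 : ∀ i : ℕ, f (((i + 1 : ℕ) : ℤ) + j) = f (i + (j + 1)) := by
      intro i; congr 1; push_cast; ring
    rw [Finset.sum_congr rfl fun i _ => h4 i] at h2
    linarith
  induction j using Int.induction_on with
  | zero => simp
  | succ j ih => rw [key, ih]
  | pred j ih => rw [← ih, ← key]; simp

theorem sum_periodic_mul {H : ℕ} (f : ℤ → ℝ) (hf : Function.Periodic f H) (m : ℕ) :
    ∑ i ∈ Finset.range (m * H), f i = m * ∑ i ∈ Finset.range H, f i := by
  induction m with
  | zero => simp
  | succ m ih =>
    rw [Nat.succ_mul, Finset.sum_range_add, ih]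
    have := sum_periodic_int f hf ((m * H : ℕ) : ℤ)
    have h2 : ∀ i : ℕ, f ((m * H + i : ℕ) : ℤ) = f (i + ((m * H : ℕ) : ℤ)) := by
      intro i; congr 1; push_cast; ring
    simp only [h2, this]
    push_cast; ring

theorem sum_diff_le (f g : ℕ → ℝ) (hf : ∀ i, 0 ≤ f i ∧ f i ≤ 1) (hg : ∀ i, 0 ≤ g i ∧ g i ≤ 1)
    (M l : ℕ) (h : ∀ i, i + l ≤ M → f i = g i) :
    |∑ i ∈ Finset.range M, f i - ∑ i ∈ Finset.range M, g i| ≤ l := by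
  rw [← Finset.sum_sub_distrib]
  refine (Finset.abs_sum_le_sum_abs _ _).trans ?_
  have h1 : ∀ i ∈ Finset.range M, |f i - g i| ≤ if M - l ≤ i then 1 else 0 := by
    intro i hi
    have := hf i; have := hg i
    split_ifs with hc
    · rw [abs_le]; constructor <;> linarith
    · rw [h i (by omega)]; simp
  refine (Finset.sum_le_sum h1).trans ?_
  rw [← Finset.sum_filter, Finset.sum_const, nsmul_eq_mul, mul_one]
  have : ((Finset.range M).filter fun i => M - l ≤ i) ⊆ Finset.Ico (M - l) M := by
    intro i hi; simp at hi ⊢; omega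
  have h2 := Finset.card_le_card this
  rw [Nat.card_Ico] at h2
  exact_mod_cast h2.trans (by omega)

/-- The indicator of an occurrence of `w` in `x` at `j`. -/
noncomputable def ind {l : ℕ} (w : Fin l → Fin 2) (x : ℤ → Fin 2) (j : ℤ) : ℝ :=
  if Occurs w x j then 1 else 0

theorem ind_bd {l : ℕ} (w : Fin l → Fin 2) (x : ℤ → Fin 2) (j : ℤ) :
    0 ≤ ind w x j ∧ ind w x j ≤ 1 := by
  unfold ind; split_ifs <;> norm_num

theorem ind_periodic (a b k : ℕ) {l : ℕ} (w : Fin l → Fin 2) :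
    Function.Periodic (ind w (periodicSeq a b k)) ((block a b k).length : ℤ) := by
  intro n
  have := occurs_periodic a b k w n
  unfold ind; simp only [this]

theorem density_eq (a b k : ℕ) {l : ℕ} (w : Fin l → Fin 2) :
    density a b k w = (∑ i ∈ Finset.range (block a b k).length, ind w (periodicSeq a b k) i) /
      (block a b k).length := by
  unfold density ind
  rw [Finset.sum_boole]

theorem density_bd (a b k : ℕ) {l : ℕ} (w : Fin l → Fin 2) :
    0 ≤ density a b k w ∧ density a b k w ≤ 1 := by
  unfold density
  refine ⟨by positivity, div_le_one_of_le₀ ?_ (by positivity)⟩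
  exact_mod_cast (Finset.card_filter_le _ _).trans (by simp)

theorem density_diff (a b k : ℕ) {l : ℕ} (w : Fin l → Fin 2) :
    |density a b (k + 1) w - density a b k w| ≤ (2 * l + 2) / ((block a b (k + 1)).length : ℝ) := by
  set H := (block a b k).length with hH
  set c : ℕ → ℝ := fun i => ind w (periodicSeq a b k) i with hc
  set c' : ℕ → ℝ := fun i => ind w (periodicSeq a b (k + 1)) i with hc'
  set M := a * b ^ k * H with hM
  set N := (b - a) * b ^ k * H with hN
  have hlen : (block a b (k + 1)).length = M + 1 + N := by
    simp only [block, List.length_append, length_flatten_replicate, List.length_singleton]; rfl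
  have e1 : |∑ i ∈ Finset.range M, c' i - ∑ i ∈ Finset.range M, c i| ≤ l := by
    refine sum_diff_le _ _ (fun i => ind_bd _ _ _) (fun i => ind_bd _ _ _) M l fun i hi => ?_
    simp only [ind]
    congr 1
    simp only [Occurs, eq_iff_iff]
    refine forall_congr' fun t => ?_
    have := periodicSeq_succ_left (a := a) (b := b) k (i + t) (by have := t.2; rw [← hH, ← hM]; omega)
    push_cast at this
    rw [this]
  have e2 : |∑ i ∈ Finset.range N, c' (M + 1 + i) - ∑ i ∈ Finset.range N, c i| ≤ l := by
    refine sum_diff_le (fun i => c' (M + 1 + i)) _ (fun i => ind_bd _ _ _)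
      (fun i => ind_bd _ _ _) N l fun i hi => ?_
    simp only [hc', ind]
    congr 1
    simp only [Occurs, eq_iff_iff]
    refine forall_congr' fun t => ?_
    have := periodicSeq_succ_right (a := a) (b := b) k (i + t) (by have := t.2; rw [← hH, ← hN]; omega)
    rw [show (((M + 1 + i : ℕ) : ℤ) + ((t : ℕ) : ℤ)) =
      ((a * b ^ k * (block a b k).length + 1 + (i + t) : ℕ) : ℤ) by push_cast [hM, hH]; ring, this]
    push_cast; rfl
  have e3 : ∑ i ∈ Finset.range M, c i = (a * b ^ k : ℕ) * ∑ i ∈ Finset.range H, c i :=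
    sum_periodic_mul _ (ind_periodic a b k w) _
  have e4 : ∑ i ∈ Finset.range N, c i = ((b - a) * b ^ k : ℕ) * ∑ i ∈ Finset.range H, c i :=
    sum_periodic_mul _ (ind_periodic a b k w) _
  have e5 := ind_bd w (periodicSeq a b (k + 1)) (M : ℕ)
  have e6 : ∑ i ∈ Finset.range (M + 1 + N), c' i =
      ∑ i ∈ Finset.range M, c' i + c' M + ∑ i ∈ Finset.range N, c' (M + 1 + i) := by
    rw [Finset.sum_range_add, Finset.sum_range_succ]
  have hd := density_bd a b k w
  have hd1 : density a b (k + 1) w = (∑ i ∈ Finset.range (M + 1 + N), c' i) / (M + 1 + N : ℕ) := by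
    rw [density_eq, hlen]
  have hHp : (0 : ℝ) < H := by exact_mod_cast length_pos a b k
  have hd2 : ∑ i ∈ Finset.range H, c i = density a b k w * H := by
    rw [density_eq, ← hH, div_mul_cancel₀ _ hHp.ne']
  have hMN : ((a * b ^ k : ℕ) : ℝ) * H + ((b - a) * b ^ k : ℕ) * H = M + N := by
    rw [hM, hN]; push_cast; ring
  have hpos : (0 : ℝ) < (M + 1 + N : ℕ) := by positivity
  have e5' : 0 ≤ c' M ∧ c' M ≤ 1 := e5
  rw [hlen, hd1, le_div_iff₀ hpos, ← abs_of_pos hpos, ← abs_mul, abs_of_pos hpos, sub_mul,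
    div_mul_cancel₀ _ hpos.ne', e6]
  rw [hd2] at e3 e4
  rw [e3] at e1
  rw [e4] at e2
  rw [abs_le] at e1 e2 ⊢
  have e7 : density a b k w * (M + 1 + N : ℕ) = (a * b ^ k : ℕ) * (density a b k w * H)
      + ((b - a) * b ^ k : ℕ) * (density a b k w * H) + density a b k w := by
    push_cast
    push_cast at hMN
    linear_combination (- density a b k w) * hMN
  constructor <;> linarith

theorem exists_tendsto_density {a b : ℕ} (ha : 1 ≤ a) (hab : a < b) {l : ℕ} (w : Fin l → Fin 2) :
    ∃ d, Tendsto (fun k => density a b k w) atTop (𝓝 d) := by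
  refine cauchySeq_tendsto_of_complete
    (cauchySeq_of_le_geometric (1 / 2) (2 * l + 2) (by norm_num) fun k => ?_)
  rw [dist_comm, Real.dist_eq]
  refine (density_diff a b k w).trans ?_
  rw [div_eq_mul_inv]
  refine mul_le_mul_of_nonneg_left ?_ (by positivity)
  rw [one_div, inv_pow]
  refine inv_anti₀ (by positivity) ?_
  have := length_ge ha hab (k + 1)
  calc (2 : ℝ) ^ k ≤ 2 ^ (k + 1) := by gcongr <;> norm_num
    _ ≤ _ := by exact_mod_cast this


theorem infix_of_occurs (L : List (Fin 2)) {l : ℕ} (w : Fin l → Fin 2) (i : ℕ)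
    (hL : i + l ≤ L.length) (h : ∀ t : Fin l, L.getD (i + t) 0 = w t) :
    List.ofFn w <:+: L := by
  have : List.ofFn w = (L.drop i).take l := by
    apply List.ext_getElem
    · simp; omega
    · intro n h1 h2
      have hn : n < l := by simpa using h1
      have := h ⟨n, hn⟩
      rw [List.getD_eq_getElem _ _ (by simp; omega)] at this
      simp [← this]
  rw [this]
  exact (List.take_prefix _ _).isInfix.trans (List.drop_suffix _ _).isInfix

theorem double_infix {a b : ℕ} (ha : 1 ≤ a) (hab : a < b) {k : ℕ} (hk : 1 ≤ k) :
    block a b k ++ block a b k <:+: block a b (k + 1) := by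
  have h2 : 2 ≤ a * b ^ k := by
    have : 2 ≤ b ^ k := le_trans (by omega) (Nat.le_self_pow (by omega : k ≠ 0) b)
    nlinarith
  obtain ⟨c, hc⟩ := Nat.exists_eq_add_of_le h2
  rw [block, hc, List.replicate_add]
  exact ⟨[], _, by simp [List.replicate]; rfl⟩

theorem density_eventually_zero {a b : ℕ} (ha : 1 ≤ a) (hab : a < b) {l : ℕ} (w : Fin l → Fin 2)
    (hw : ∀ k, ¬ (List.ofFn w <:+: block a b k)) :
    Tendsto (fun k => density a b k w) atTop (𝓝 0) := by
  refine tendsto_const_nhds.congr' ?_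
  filter_upwards [eventually_ge_atTop (l + 1)] with k hk
  have hlen : l ≤ (block a b k).length := by
    have := length_ge ha hab k
    have := (Nat.lt_two_pow_self (n := k))
    omega
  unfold density
  rw [Finset.filter_eq_empty_iff.2]
  · simp
  · intro i hi ho
    refine hw (k + 1) (List.IsInfix.trans ?_ (double_infix ha hab (by omega : 1 ≤ k)))
    have hi' : i < (block a b k).length := by simpa using hi
    refine infix_of_occurs _ w i (by simp; omega) fun t => ?_
    have ht := t.2
    have h1 := ho t
    have h2 := periodicSeq_natCast a b k (i + t)
    push_cast at h2
    rw [← h1, h2]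
    have h3 := getD_flatten_replicate (block a b k) 2 (i + t) (by omega)
    simpa [List.replicate] using h3

theorem isClopen_occurs {l : ℕ} (w : Fin l → Fin 2) (j : ℤ) :
    IsClopen {x : ℤ → Fin 2 | Occurs w x j} := by
  have : {x : ℤ → Fin 2 | Occurs w x j} = ⋂ i : Fin l, (fun x => x (j + i)) ⁻¹' {w i} := by
    ext x; simp [Occurs]
  rw [this]
  exact isClopen_iInter_of_finite fun i => (isClopen_discrete _).preimage (continuous_apply _)

/-- The uniform measure on the shift orbit of `⋯ B_k B_k B_k ⋯`. -/
noncomputable def orbitMeasure (a b k : ℕ) : Measure (ℤ → Fin 2) :=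
  ((block a b k).length : ℝ≥0∞)⁻¹ • ∑ i ∈ Finset.range (block a b k).length,
    Measure.dirac (fun n : ℤ => periodicSeq a b k (n + i))

instance (a b k : ℕ) : IsProbabilityMeasure (orbitMeasure a b k) := by
  constructor
  have h := (length_pos a b k).ne'
  simp [orbitMeasure]
  exact ENNReal.inv_mul_cancel (by exact_mod_cast h) (by simp)

theorem orbitMeasure_occurs (a b k : ℕ) {l : ℕ} (w : Fin l → Fin 2) (j : ℤ) :
    (orbitMeasure a b k).real {x | Occurs w x j} = density a b k w := by
  have hm := (isClopen_occurs w j).isOpen.measurableSet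
  rw [density_eq, ← sum_periodic_int _ (ind_periodic a b k w) j, orbitMeasure, Measure.real,
    Measure.smul_apply, Measure.finsetSum_apply, smul_eq_mul, ENNReal.toReal_mul,
    ENNReal.toReal_sum (fun i _ => measure_ne_top _ _), ENNReal.toReal_inv, ENNReal.toReal_natCast,
    div_eq_inv_mul]
  congr 1
  refine Finset.sum_congr rfl fun i _ => ?_
  have e : (fun n : ℤ => periodicSeq a b k (n + i)) ∈ {x | Occurs w x j} ↔
      Occurs w (periodicSeq a b k) (i + j) := by
    simp only [Occurs, mem_ofPred_eq]
    refine forall_congr' fun t => ?_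
    rw [show j + (t : ℤ) + i = i + j + t by ring]
  rw [Measure.dirac_apply' _ hm]
  unfold ind
  by_cases h : Occurs w (periodicSeq a b k) (i + j)
  · rw [Set.indicator_of_mem (e.2 h), if_pos h]; simp
  · rw [Set.indicator_of_notMem (fun h' => h (e.1 h')), if_neg h]; simp

theorem exists_measure_full {a b : ℕ} (ha : 1 ≤ a) (hab : a < b) :
    ∃ μ : Measure (ℤ → Fin 2), IsProbabilityMeasure μ ∧
      ∀ (j : ℤ) {l : ℕ} (w : Fin l → Fin 2),
        Tendsto (fun k => density a b k w) atTop (𝓝 (μ.real {x | Occurs w x j})) := by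
  let ν : ℕ → ProbabilityMeasure (ℤ → Fin 2) := fun k => ⟨orbitMeasure a b k, inferInstance⟩
  let U : Ultrafilter ℕ := Ultrafilter.of atTop
  have hU : (U : Filter ℕ) ≤ atTop := Ultrafilter.of_le atTop
  obtain ⟨μ, -, hμ⟩ := isCompact_univ.ultrafilter_le_nhds (U.map ν) (by simp)
  have hμ' : Tendsto ν U (𝓝 μ) := hμ
  refine ⟨μ, inferInstance, fun j l w => ?_⟩
  obtain ⟨d, hd⟩ := exists_tendsto_density ha hab w
  have h1 := ProbabilityMeasure.tendsto_measure_of_isClopen_of_tendsto hμ' (isClopen_occurs w j)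
  have h2 : Tendsto (fun k => density a b k w) U (𝓝 ((μ : Measure _).real {x | Occurs w x j})) := by
    have h3 := (NNReal.continuous_coe.tendsto _).comp h1
    refine h3.congr fun k => ?_
    exact orbitMeasure_occurs a b k w j
  rwa [tendsto_nhds_unique h2 (hd.mono_left hU)]

theorem compl_shiftSpace (a b : ℕ) : (shiftSpace a b)ᶜ =
    ⋃ (m : ℤ) (l : ℕ) (w : {w : Fin l → Fin 2 // ∀ k, ¬ (List.ofFn w <:+: block a b k)}),
      {x | Occurs w.1 x m} := by
  ext x
  simp only [shiftSpace, mem_compl_iff, mem_ofPred_eq, not_forall, not_exists, mem_iUnion,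
    Subtype.exists]
  constructor
  · rintro ⟨m, l, h⟩
    exact ⟨m, l, fun i => x (m + i), h, fun i => rfl⟩
  · rintro ⟨m, l, w, h, ho⟩
    refine ⟨m, l, ?_⟩
    have : (fun i : Fin l => x (m + i)) = w := funext ho
    rwa [this]

theorem measurableSet_shiftSpace (a b : ℕ) : MeasurableSet (shiftSpace a b) := by
  refine MeasurableSet.of_compl ?_
  rw [compl_shiftSpace]
  exact MeasurableSet.iUnion fun m => MeasurableSet.iUnion fun l => MeasurableSet.iUnion fun w =>
    (isClopen_occurs w.1 m).isOpen.measurableSet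

/-- The cylinder set with name `w` at position `j`. -/
def cylinder {a b : ℕ} (j : ℤ) {l : ℕ} (w : Fin l → Fin 2) : Set (shiftSpace a b) :=
  {x | Occurs w x.1 j}

theorem measurableSet_cylinder {a b : ℕ} (j : ℤ) {l : ℕ} (w : Fin l → Fin 2) :
    MeasurableSet (cylinder j w : Set (shiftSpace a b)) :=
  measurable_subtype_coe (isClopen_occurs w j).isOpen.measurableSet

theorem exists_measure {a b : ℕ} (ha : 1 ≤ a) (hab : a < b) :
    ∃ μ : Measure (shiftSpace a b), IsProbabilityMeasure μ ∧
      ∀ (j : ℤ) {l : ℕ} (w : Fin l → Fin 2),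
        Tendsto (fun k => density a b k w) atTop (𝓝 (μ.real (cylinder j w))) := by
  obtain ⟨ν, hν, h⟩ := exists_measure_full ha hab
  have hX : ν (shiftSpace a b)ᶜ = 0 := by
    rw [compl_shiftSpace]
    refine measure_iUnion_null fun m => measure_iUnion_null fun l => measure_iUnion_null fun w => ?_
    have h1 := tendsto_nhds_unique (h m w.1) (density_eventually_zero ha hab w.1 w.2)
    rwa [measureReal_eq_zero_iff] at h1
  have hme := MeasurableEmbedding.subtype_coe (measurableSet_shiftSpace a b)
  have happ : ∀ s : Set (ℤ → Fin 2),
      ν.comap ((↑) : shiftSpace a b → ℤ → Fin 2) (Subtype.val ⁻¹' s) = ν s := by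
    intro s
    rw [hme.comap_apply, Subtype.image_preimage_coe, inter_comm]
    exact measure_inter_conull hX
  refine ⟨ν.comap (↑), ⟨?_⟩, fun j l w => ?_⟩
  · have := happ univ
    rwa [preimage_univ, hν.measure_univ] at this
  · have h1 : (ν.comap ((↑) : shiftSpace a b → ℤ → Fin 2)).real (cylinder j w) =
        ν.real {x | Occurs w x j} := by
      simp only [Measure.real]
      congr 1
      exact happ {x | Occurs w x j}
    rw [h1]
    exact h j w

/-- The measure of the system: the probability measure on the phase space that gives each cylinder
set with name `w` the mass `lim_k d_k(w)` (see `tendsto_density`). It is unique, because the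
cylinder sets generate the σ-algebra. -/
noncomputable def measure {a b : ℕ} (ha : 1 ≤ a) (hab : a < b) : Measure (shiftSpace a b) :=
  (exists_measure ha hab).choose

instance {a b : ℕ} (ha : 1 ≤ a) (hab : a < b) : IsProbabilityMeasure (measure ha hab) :=
  (exists_measure ha hab).choose_spec.1

theorem tendsto_density {a b : ℕ} (ha : 1 ≤ a) (hab : a < b) (j : ℤ) {l : ℕ} (w : Fin l → Fin 2) :
    Tendsto (fun k => density a b k w) atTop (𝓝 ((measure ha hab).real (cylinder j w))) :=
  (exists_measure ha hab).choose_spec.2 j w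

/-- The cylinder sets on the windows `[-n, n]`. -/
def centralCylinders (a b : ℕ) : Set (Set (shiftSpace a b)) :=
  {s | ∃ (n : ℕ) (w : Fin (2 * n + 1) → Fin 2), s = cylinder (-n) w}

theorem isPiSystem_centralCylinders (a b : ℕ) : IsPiSystem (centralCylinders a b) := by
  have key : ∀ (n n' : ℕ) (w : Fin (2 * n + 1) → Fin 2) (w' : Fin (2 * n' + 1) → Fin 2),
      n ≤ n' → ((cylinder (-n) w : Set (shiftSpace a b)) ∩ cylinder (-n') w').Nonempty →
      (cylinder (-n') w' : Set (shiftSpace a b)) ⊆ cylinder (-n) w := by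
    rintro n n' w w' hn ⟨x, hx, hx'⟩ y hy i
    have hi := i.2
    have h1 := hx i
    have h2 := hx' ⟨n' - n + i, by omega⟩
    have h3 := hy ⟨n' - n + i, by omega⟩
    rw [← h1]
    have e : (-(n' : ℤ) + ((n' - n + (i : ℕ) : ℕ) : ℤ)) = -(n : ℤ) + i := by
      push_cast [Nat.cast_sub hn]; ring
    simp only [e] at h2 h3
    rw [h3, h2]
  rintro _ ⟨n, w, rfl⟩ _ ⟨n', w', rfl⟩ hne
  rcases le_total n n' with hn | hn
  · exact ⟨n', w', inter_eq_right.2 (key n n' w w' hn hne)⟩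
  · exact ⟨n, w, inter_eq_left.2 (key n' n w' w hn (by rwa [inter_comm]))⟩

theorem generateFrom_centralCylinders (a b : ℕ) :
    (inferInstance : MeasurableSpace (shiftSpace a b)) =
      MeasurableSpace.generateFrom (centralCylinders a b) := by
  apply le_antisymm
  · have hm : @Measurable _ _ (MeasurableSpace.generateFrom (centralCylinders a b)) _
        (fun x : shiftSpace a b => x.1) := by
      refine @measurable_pi_lambda _ _ _ (MeasurableSpace.generateFrom (centralCylinders a b)) _ _
        fun n => ?_
      refine @measurable_to_countable' _ _ _ _ (MeasurableSpace.generateFrom _) _ fun c => ?_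
      have e : (fun x : shiftSpace a b => x.1 n) ⁻¹' {c} =
          ⋃ w : {w : Fin (2 * n.natAbs + 1) → Fin 2 //
            w ⟨(n + n.natAbs).toNat, by omega⟩ = c}, cylinder (-n.natAbs) w.1 := by
        ext x
        have e1 : (-(n.natAbs : ℤ) + ((n + n.natAbs).toNat : ℕ)) = n := by omega
        simp only [mem_preimage, mem_singleton_iff, mem_iUnion, Subtype.exists, exists_prop]
        constructor
        · intro h
          refine ⟨fun i => x.1 (-n.natAbs + i), ?_, fun i => rfl⟩
          simp only [e1]; exact h
        · rintro ⟨w, h, ho⟩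
          have := ho ⟨(n + n.natAbs).toNat, by omega⟩
          simp only [e1] at this
          rw [this, h]
      rw [e]
      exact MeasurableSet.iUnion fun w => MeasurableSpace.measurableSet_generateFrom ⟨_, _, rfl⟩
    exact hm.comap_le
  · refine MeasurableSpace.generateFrom_le ?_
    rintro _ ⟨n, w, rfl⟩
    exact measurableSet_cylinder _ _

/-- The left shift `T` on the phase space. -/
def shift (a b : ℕ) : Equiv.Perm (shiftSpace a b) where
  toFun x := ⟨fun n => x.1 (n + 1), fun m l => by
    have := x.2 (m + 1) l
    simpa only [add_right_comm] using this⟩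
  invFun x := ⟨fun n => x.1 (n - 1), fun m l => by
    have := x.2 (m - 1) l
    simpa only [sub_add_eq_add_sub] using this⟩
  left_inv x := by ext n; simp
  right_inv x := by ext n; simp

theorem measurable_shift (a b : ℕ) : Measurable (shift a b) :=
  Measurable.subtype_mk (f := fun (x : shiftSpace a b) (n : ℤ) => x.1 (n + 1))
    (measurable_pi_lambda _ fun n => (measurable_pi_apply (n + 1)).comp measurable_subtype_coe)

theorem measurable_shift_symm (a b : ℕ) : Measurable (shift a b).symm :=
  Measurable.subtype_mk (f := fun (x : shiftSpace a b) (n : ℤ) => x.1 (n - 1))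
    (measurable_pi_lambda _ fun n => (measurable_pi_apply (n - 1)).comp measurable_subtype_coe)

theorem measurePreserving_shift {a b : ℕ} (ha : 1 ≤ a) (hab : a < b) :
    MeasurePreserving (shift a b) (measure ha hab) (measure ha hab) := by
  refine ⟨measurable_shift a b, ?_⟩
  have := Measure.isProbabilityMeasure_map (μ := measure ha hab) (measurable_shift a b).aemeasurable
  refine ext_of_generate_finite _ (generateFrom_centralCylinders a b)
    (isPiSystem_centralCylinders a b) ?_ (by simp)
  rintro _ ⟨n, w, rfl⟩
  rw [Measure.map_apply (measurable_shift a b) (measurableSet_cylinder _ _)]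
  have e : shift a b ⁻¹' (cylinder (-n) w) = cylinder (-n + 1) w := by
    ext x
    simp only [cylinder, Occurs, shift, mem_preimage, Equiv.coe_fn_mk, mem_ofPred_eq]
    refine forall_congr' fun i => ?_
    rw [add_right_comm]
  rw [e, ← ENNReal.toReal_eq_toReal_iff' (measure_ne_top _ _) (measure_ne_top _ _)]
  exact tendsto_nhds_unique (tendsto_density ha hab _ w) (tendsto_density ha hab _ w)

theorem measurePreserving_shift_symm {a b : ℕ} (ha : 1 ≤ a) (hab : a < b) :
    MeasurePreserving (shift a b).symm (measure ha hab) (measure ha hab) := by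
  let e : shiftSpace a b ≃ᵐ shiftSpace a b :=
    ⟨shift a b, measurable_shift a b, measurable_shift_symm a b⟩
  exact MeasurePreserving.symm e (measurePreserving_shift ha hab)

section Automorphisms

variable {X : Type*} [MeasurableSpace X]

/-- The invertible bimeasurable `μ`-preserving transformations of `X`. -/
def autGroup (μ : Measure X) : Subgroup (Equiv.Perm X) where
  carrier := {e | MeasurePreserving e μ μ ∧ MeasurePreserving e.symm μ μ}
  mul_mem' h₁ h₂ := ⟨h₁.1.comp h₂.1, h₂.2.comp h₁.2⟩
  one_mem' := ⟨MeasurePreserving.id μ, MeasurePreserving.id μ⟩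
  inv_mem' h := ⟨h.2, h.1⟩

/-- The transformations that agree with the identity almost everywhere. -/
def nullGroup (μ : Measure X) : Subgroup (autGroup μ) where
  carrier := {e | ∀ᵐ x ∂μ, e.1 x = x}
  mul_mem' {e f} he hf := by
    filter_upwards [hf, f.2.1.quasiMeasurePreserving.ae he] with x h1 h2
    exact h2.trans h1
  one_mem' := by simp
  inv_mem' {e} he := by
    change ∀ᵐ x ∂μ, e.1.symm x = x
    filter_upwards [he] with x hx
    exact (Equiv.symm_apply_eq _).2 hx.symm

instance (μ : Measure X) : (nullGroup μ).Normal where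
  conj_mem e he f := by
    have := f.2.2.quasiMeasurePreserving.ae he
    filter_upwards [this] with x hx
    change f.1 (e.1 (f.1.symm x)) = x
    rw [hx, Equiv.apply_symm_apply]

/-- `Aut(X, μ)`: invertible measure-preserving transformations modulo almost everywhere equality. -/
abbrev Aut (μ : Measure X) : Type _ := autGroup μ ⧸ nullGroup μ

/-- The image of a measurable set. -/
def autGroup.image {μ : Measure X} (e : autGroup μ) (A : MeasuredSets μ) : MeasuredSets μ :=
  ⟨e.1 '' (A : Set X), by rw [Equiv.image_eq_preimage_symm]; exact e.2.2.measurable A.2⟩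

/-- The weak topology: the coarsest one for which every map `e ↦ e(A)` is continuous, where measurable
sets carry the distance `μ (A ∆ B)`. Hence `e_n → e` iff `μ (e_n(A) ∆ e(A)) → 0` for every measurable
`A`. Its open sets are unions of classes of a.e. equal maps; `Aut μ` gets the quotient topology. -/
noncomputable instance autGroup.weakTopology (μ : Measure X) : TopologicalSpace (autGroup μ) :=
  ⨅ A : MeasuredSets μ, TopologicalSpace.induced (fun e => autGroup.image e A) inferInstance

/-- Rank one: every finite measurable partition `P` is approximated by Rokhlin towers: for each
`ε > 0` there are disjoint levels `F, f F, …, f^{h-1} F` that cover `X` up to measure `ε`, and a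
partition `Q`, coarser than the partition into these levels and the remaining set, that differs
from `P` only on a set of measure less than `ε`. -/
def IsRankOne (f : X → X) (μ : Measure X) : Prop :=
  ∀ (n : ℕ) (P : X → Fin n), Measurable P → ∀ ε : ℝ≥0∞, 0 < ε →
    ∃ (F : Set X) (h : ℕ) (Q : X → Fin n), MeasurableSet F ∧ 0 < h ∧
      (∀ i < h, ∀ j < h, i ≠ j → Disjoint (f^[i] '' F) (f^[j] '' F)) ∧
      μ (⋃ i < h, f^[i] '' F)ᶜ < ε ∧
      Measurable Q ∧
      (∀ i < h, ∃ c, ∀ x ∈ f^[i] '' F, Q x = c) ∧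
      (∃ c, ∀ x ∈ (⋃ i < h, f^[i] '' F)ᶜ, Q x = c) ∧
      μ {x | P x ≠ Q x} < ε

/-- An element of `Aut μ` is rank one if a representative is (equivalently, every representative:
a null set can be removed from the base of a tower). -/
def IsRankOneAut {μ : Measure X} (S : Aut μ) : Prop :=
  ∃ e : autGroup μ, (QuotientGroup.mk e : Aut μ) = S ∧ IsRankOne e.1 μ

/-- The weak closure of `S`: the closure of `{S ^ n | n ∈ ℤ}` in `Aut μ`. -/
def weakClosure {μ : Measure X} (S : Aut μ) : Set (Aut μ) :=
  closure (Set.range fun n : ℤ => S ^ n)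

end Automorphisms

/-- The generalized del Junco–Rudolph map with parameters `a`, `b`, as an element of `Aut μ`. -/
noncomputable def genMap {a b : ℕ} (ha : 1 ≤ a) (hab : a < b) : Aut (measure ha hab) :=
  QuotientGroup.mk ⟨shift a b, measurePreserving_shift ha hab, measurePreserving_shift_symm ha hab⟩

end DJR

/-!
The idea is that every positive power `T ^ m` of the shift is itself rank one, while the powers with
positive exponent are already dense in the weak closure.

*Positive powers have exact towers.* Write `h_k = |B_k|`, so that `h_{k+1} = b ^ (k+1) h_k + 1`.
Modulo an integer prime to `b` the sequence `h_k` is periodic and starts at `1`, and it is prime to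
`b` throughout; hence `m` is prime to `h_k` for infinitely many `k` (`exists_coprime_length`).
The points at which a long power of `B_k` begins serve as base of a tower of height `h_k` for
`T ^ m`. Its levels are disjoint because `m` is prime to `h_k` and because `B_k` is primitive, so
that a power of `B_k` contains `B_k` only at the multiples of `h_k` (`length_dvd_of_periodic`,
`disjoint_towerLevel`); in particular no recognizability of single blocks is needed. The levels
nearly cover the space because `B_{k+1}` consists, up to one letter, of two powers of `B_k` with
exponents at least `b ^ k`, which tends to infinity (`measureReal_cylinder_powWord`).

*Rigidity.* For the same reason a typical point has period `h_k` around the origin, so that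
`T ^ h_k` tends to the identity (`tendsto_image_shiftAut_length`). Hence `T ^ (n + h_k)` tends to
`T ^ n` for every integer `n`, which gives the density of the positive powers.

*Rank one is a `Gδ` condition.* The existence of an approximate tower whose levels determine the
coordinates in a given window is an open condition on the transformation (`isOpen_approxTower`).
An approximate tower contains an exact one (`exists_tower_of_mem_approxTower`), and every finite
partition is approximated by window partitions, so that a transformation in the countable
intersection of these open sets is rank one (`isRankOne_of_mem_approxTower`). The open sets consist
of whole classes of almost everywhere equal maps (`autGroup.mem_of_mk_mem_image`) and therefore
descend to the quotient `Aut μ`.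
-/

namespace DJR

open MeasureTheory Filter Topology Set
open scoped ENNReal symmDiff

/-! ### Arithmetic of the block lengths -/

theorem coprime_length {a b : ℕ} (hab : a < b) (k : ℕ) : b.Coprime (block a b k).length := by
  cases k with
  | zero => simp [block]
  | succ k =>
    rw [length_succ hab, pow_succ', mul_assoc]
    simp

/-- Modulo a number prime to `b`, the pair `(b ^ k, |B_k|)` evolves by an injective map of a finite
set, so it returns to its initial value `(1, 1)` infinitely often. -/
theorem exists_length_modEq_one {a b : ℕ} (hab : a < b) {q : ℕ} (hq : q ≠ 0) (hqb : b.Coprime q)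
    (K : ℕ) : ∃ k ≥ K, (block a b k).length ≡ 1 [MOD q] := by
  have : NeZero q := ⟨hq⟩
  let β : (ZMod q)ˣ := ZMod.unitOfCoprime b hqb
  let f : (ZMod q)ˣ × ZMod q → (ZMod q)ˣ × ZMod q :=
    fun s => (β * s.1, (β * s.1 : ZMod q) * s.2 + 1)
  have hf : Function.Injective f := by
    rintro ⟨u, h⟩ ⟨u', h'⟩ he
    simp only [f, Prod.mk.injEq, mul_right_inj] at he
    obtain ⟨rfl, he⟩ := he
    have h1 := add_right_cancel he
    rw [← Units.val_mul, Units.mul_right_inj] at h1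
    rw [h1]
  have hit : ∀ k, f^[k] (1, 1) = (β ^ k, ((block a b k).length : ZMod q)) := by
    intro k
    induction k with
    | zero => simp [block]
    | succ k ih =>
      rw [Function.iterate_succ_apply', ih, length_succ hab]
      simp only [f, Prod.mk.injEq]
      refine ⟨(pow_succ' β k).symm, ?_⟩
      push_cast [β, ZMod.coe_unitOfCoprime]
      ring
  obtain ⟨t, ht, hper⟩ := hf.mem_periodicPts (1, 1)
  -- The factor `K + 1` only makes the return time large.
  refine ⟨t * (K + 1), by nlinarith, ?_⟩
  have h1 : f^[t * (K + 1)] (1, 1) = (1, 1) := hper.mul_const (K + 1)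
  rw [hit] at h1
  have h2 := congrArg Prod.snd h1
  rw [← ZMod.natCast_eq_natCast_iff]
  simpa using h2

theorem exists_coprime_length {a b : ℕ} (hab : a < b) {m : ℕ} (hm : m ≠ 0) (K : ℕ) :
    ∃ k ≥ K, m.Coprime (block a b k).length := by
  classical
  -- Prime divisors of `b` never divide a block length, so only the other ones matter.
  set q := ∏ p ∈ m.primeFactors.filter (fun p => ¬ p ∣ b), p with hq
  have hqb : b.Coprime q := Nat.Coprime.prod_right fun p hp => by
    simp only [Finset.mem_filter, Nat.mem_primeFactors] at hp
    exact ((Nat.Prime.coprime_iff_not_dvd hp.1.1).2 hp.2).symm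
  have hq0 : q ≠ 0 := Finset.prod_ne_zero_iff.2 fun p hp => by
    simp only [Finset.mem_filter, Nat.mem_primeFactors] at hp
    exact hp.1.1.ne_zero
  obtain ⟨k, hk, hmod⟩ := exists_length_modEq_one hab hq0 hqb K
  refine ⟨k, hk, Nat.coprime_of_dvd fun p hp hpm hph => ?_⟩
  by_cases hpb : p ∣ b
  · exact Nat.not_coprime_of_dvd_of_dvd hp.one_lt hpb hph (coprime_length hab k)
  · have hpq : p ∣ q := Finset.dvd_prod_of_mem _
      (Finset.mem_filter.2 ⟨Nat.mem_primeFactors.2 ⟨hp, hpm, hm⟩, hpb⟩)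
    exact hp.one_lt.ne' (Nat.dvd_one.1 (((hmod.of_dvd hpq).dvd_iff dvd_rfl).1 hph))

/-! ### Primitivity of the blocks -/

theorem count_flatten_replicate (L : List (Fin 2)) (m : ℕ) :
    (List.replicate m L).flatten.count 0 = m * L.count 0 := by
  simp [List.count_flatten]

theorem exists_count_zero_eq_pow {a b : ℕ} (hab : a < b) (k : ℕ) :
    ∃ e, (block a b k).count 0 = b ^ e := by
  induction k with
  | zero => exact ⟨0, by simp [block]⟩
  | succ k ih =>
    obtain ⟨e, he⟩ := ih
    refine ⟨k + 1 + e, ?_⟩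
    rw [block, List.count_append, List.count_append, count_flatten_replicate,
      count_flatten_replicate, he]
    obtain ⟨c, rfl⟩ := Nat.exists_eq_add_of_lt hab
    rw [show a + c + 1 - a = c + 1 by omega]
    simp
    ring

theorem sum_getD_eq_count (L : List (Fin 2)) :
    ∑ i ∈ Finset.range L.length, (if L.getD i 0 = 0 then 1 else 0 : ℝ) = L.count 0 := by
  induction L with
  | nil => simp
  | cons x L ih =>
    rw [List.length_cons, Finset.sum_range_succ', List.count_cons]
    simp only [List.getD_cons_succ, List.getD_cons_zero, ih]
    by_cases hx : x = 0 <;> simp [hx]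

/-- The word `B_k` is primitive: the least period of `⋯ B_k B_k B_k ⋯` is `|B_k|`. A smaller period
would divide `|B_k|`, with a quotient that also divides the number of zeros of `B_k`; that number is
a power of `b`, hence prime to `|B_k|`. -/
theorem length_dvd_of_periodic {a b : ℕ} (hab : a < b) (k : ℕ) {s : ℤ}
    (hs : Function.Periodic (periodicSeq a b k) s) : ((block a b k).length : ℤ) ∣ s := by
  set h := (block a b k).length with hh
  have hpos : 0 < h := length_pos a b k
  set g := Int.gcd s h with hg
  have hper : Function.Periodic (periodicSeq a b k) (g : ℤ) := by
    have e : (g : ℤ) = Int.gcdA s h * s + Int.gcdB s h * h := by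
      rw [hg, Int.gcd_eq_gcd_ab]; ring
    rw [e]
    exact (hs.int_mul _).add_period (Function.Periodic.int_mul (periodicSeq_add a b k) _)
  obtain ⟨q, hq⟩ : g ∣ h := Int.natCast_dvd_natCast.1 (Int.gcd_dvd_right s h)
  have hsum := sum_periodic_mul (H := g) (fun n => if periodicSeq a b k n = 0 then 1 else 0)
    (fun n => by simp only [hper n]) q
  have h1 : ∑ i ∈ Finset.range h, (if periodicSeq a b k i = 0 then 1 else 0 : ℝ) =
      (block a b k).count 0 := by
    rw [← sum_getD_eq_count]
    refine Finset.sum_congr rfl fun i hi => ?_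
    rw [periodicSeq_natCast, Nat.mod_eq_of_lt (Finset.mem_range.1 hi)]
  rw [mul_comm, ← hq, h1, Finset.sum_boole] at hsum
  have hdvd : q ∣ (block a b k).count 0 := ⟨_, by exact_mod_cast hsum⟩
  obtain ⟨e, he⟩ := exists_count_zero_eq_pow hab k
  have hq1 : q = 1 := Nat.eq_one_of_dvd_coprimes ((coprime_length hab k).pow_left e)
    (he ▸ hdvd) ⟨g, by rw [← hh, hq]; ring⟩
  rw [hq, hq1, mul_one]
  exact Int.gcd_dvd_left s h

/-! ### Counting occurrences of a word -/

/-- The number of occurrences of the word `w` in the word `L`. -/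
def occ (w : List (Fin 2)) : List (Fin 2) → ℕ
  | [] => 0
  | x :: L => (if w <+: x :: L then 1 else 0) + occ w L

theorem occ_add_le_append (w u v : List (Fin 2)) : occ w u + occ w v ≤ occ w (u ++ v) := by
  induction u with
  | nil => simp [occ]
  | cons x u ih =>
    rw [List.cons_append, occ, occ]
    have : (if w <+: x :: u then 1 else 0) ≤ if w <+: x :: (u ++ v) then 1 else 0 := by
      split_ifs with h1 h2
      · exact le_rfl
      · exact absurd (h1.trans (List.prefix_append (x :: u) v)) h2
      all_goals simp
    omega

theorem mul_occ_le_flatten_replicate (w u : List (Fin 2)) (m : ℕ) :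
    m * occ w u ≤ occ w (List.replicate m u).flatten := by
  induction m with
  | zero => simp
  | succ m ih =>
    rw [List.replicate_succ, List.flatten_cons, Nat.succ_mul]
    have := occ_add_le_append w u (List.replicate m u).flatten
    omega

/-- The power `u ^ L` occurs in `u ^ m` at all multiples of `|u|`, up to the last `L`. -/
theorem le_occ_flatten_replicate {u : List (Fin 2)} (hu : u ≠ []) (L m : ℕ) :
    m ≤ occ (List.replicate L u).flatten (List.replicate m u).flatten + L := by
  induction m with
  | zero => simp
  | succ m ih =>
    rcases Nat.lt_or_ge m L with h | h
    · omega
    · have hp : (List.replicate L u).flatten <+: (List.replicate (m + 1) u).flatten := by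
        obtain ⟨c, hc⟩ := Nat.exists_eq_add_of_le (h.trans m.le_succ)
        rw [← Nat.succ_eq_add_one, hc, List.replicate_add, List.flatten_append]
        exact List.prefix_append _ _
      obtain ⟨x, u', rfl⟩ := List.exists_cons_of_ne_nil hu
      have h2 := occ_add_le_append (List.replicate L (x :: u')).flatten u'
        (List.replicate m (x :: u')).flatten
      rw [List.replicate_succ, List.flatten_cons, List.cons_append] at hp ⊢
      rw [occ, if_pos hp]
      omega

theorem occ_eq_sum (w L : List (Fin 2)) :
    occ w L = ∑ i ∈ Finset.range L.length, if w <+: L.drop i then 1 else 0 := by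
  induction L with
  | nil => simp [occ]
  | cons x L ih =>
    rw [List.length_cons, Finset.sum_range_succ', occ, ih]
    simp [add_comm]

theorem occ_le_density_mul {l : ℕ} (a b k : ℕ) (w : Fin l → Fin 2) :
    (occ (List.ofFn w) (block a b k) : ℝ) ≤ density a b k w * (block a b k).length := by
  have hpos : (0 : ℝ) < (block a b k).length := by exact_mod_cast length_pos a b k
  rw [density_eq, div_mul_cancel₀ _ hpos.ne', occ_eq_sum, Nat.cast_sum]
  refine Finset.sum_le_sum fun i hi => ?_
  split_ifs with h
  · have ho : Occurs w (periodicSeq a b k) i := by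
      intro t
      have hl := h.length_le
      have ht := t.2
      simp only [List.length_ofFn, List.length_drop] at hl
      have h1 := h.getElem (i := t) (by simp)
      have h2 := periodicSeq_natCast a b k (i + t)
      push_cast at h2
      rw [h2, Nat.mod_eq_of_lt (by omega), List.getD_eq_getElem _ _ (by omega)]
      simp at h1
      exact h1.symm
    simp [ind, ho]
  · simpa using (ind_bd w (periodicSeq a b k) i).1

/-- The word `B_k ^ L`. -/
def powWord (a b k L : ℕ) : Fin (L * (block a b k).length) → Fin 2 :=
  fun i => periodicSeq a b k (i : ℕ)

theorem ofFn_powWord (a b k L : ℕ) :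
    List.ofFn (powWord a b k L) = (List.replicate L (block a b k)).flatten := by
  refine List.ext_getElem (by simp) fun i h1 h2 => ?_
  have hi : i < L * (block a b k).length := by simpa using h1
  rw [List.getElem_ofFn, ← List.getD_eq_getElem _ 0 h2, getD_flatten_replicate _ _ _ hi]
  exact periodicSeq_natCast a b k i

theorem le_occ_block_succ {a b : ℕ} (hab : a < b) (k L : ℕ) :
    b ^ (k + 1) ≤ occ (List.ofFn (powWord a b k L)) (block a b (k + 1)) + 2 * L := by
  have hne : block a b k ≠ [] := List.ne_nil_of_length_pos (length_pos a b k)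
  rw [ofFn_powWord, block]
  have h1 := le_occ_flatten_replicate hne L (a * b ^ k)
  have h2 := le_occ_flatten_replicate hne L ((b - a) * b ^ k)
  have h3 := occ_add_le_append (List.replicate L (block a b k)).flatten
    ((List.replicate (a * b ^ k) (block a b k)).flatten ++ [1])
    (List.replicate ((b - a) * b ^ k) (block a b k)).flatten
  have h4 := occ_add_le_append (List.replicate L (block a b k)).flatten
    (List.replicate (a * b ^ k) (block a b k)).flatten [1]
  have h5 : b ^ (k + 1) = a * b ^ k + (b - a) * b ^ k := by
    rw [← Nat.add_mul, Nat.add_sub_cancel' hab.le, pow_succ']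
  omega

theorem mul_occ_le_occ_block_succ {a b : ℕ} (hab : a < b) (w : List (Fin 2)) (k : ℕ) :
    b ^ (k + 1) * occ w (block a b k) ≤ occ w (block a b (k + 1)) := by
  rw [block]
  have h1 := mul_occ_le_flatten_replicate w (block a b k) (a * b ^ k)
  have h2 := mul_occ_le_flatten_replicate w (block a b k) ((b - a) * b ^ k)
  have h3 := occ_add_le_append w ((List.replicate (a * b ^ k) (block a b k)).flatten ++ [1])
    (List.replicate ((b - a) * b ^ k) (block a b k)).flatten
  have h4 := occ_add_le_append w (List.replicate (a * b ^ k) (block a b k)).flatten [1]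
  have h5 : b ^ (k + 1) = a * b ^ k + (b - a) * b ^ k := by
    rw [← Nat.add_mul, Nat.add_sub_cancel' hab.le, pow_succ']
  rw [h5, Nat.add_mul]
  omega

/-- The frequency of a word in `B_j` cannot drop from one `j` to the next, if it is taken relative
to `|B_j| + 1`: a spacer costs at most one letter, which the summand `1` absorbs. -/
theorem occ_mul_le {a b : ℕ} (ha : 1 ≤ a) (hab : a < b) (w : List (Fin 2)) {k j : ℕ} (h : k ≤ j) :
    occ w (block a b k) * ((block a b j).length + 1) ≤
      occ w (block a b j) * ((block a b k).length + 1) := by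
  induction j, h using Nat.le_induction with
  | base => exact le_rfl
  | succ j _ ih =>
    have h1 := mul_occ_le_occ_block_succ hab w j
    have h2 : 2 ≤ b ^ (j + 1) := le_trans (by omega) (Nat.le_self_pow (by omega) b)
    calc occ w (block a b k) * ((block a b (j + 1)).length + 1)
        ≤ occ w (block a b k) * (b ^ (j + 1) * ((block a b j).length + 1)) := by
          rw [length_succ hab]; gcongr; rw [mul_add]; omega
      _ = b ^ (j + 1) * (occ w (block a b k) * ((block a b j).length + 1)) := by ring
      _ ≤ b ^ (j + 1) * (occ w (block a b j) * ((block a b k).length + 1)) := by gcongr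
      _ = b ^ (j + 1) * occ w (block a b j) * ((block a b k).length + 1) := by ring
      _ ≤ _ := by gcongr

/-- The cylinder of `B_k ^ L` has almost the largest mass that is possible for the base of a tower
of height `|B_k|`. -/
theorem measureReal_cylinder_powWord {a b : ℕ} (ha : 1 ≤ a) (hab : a < b) (k L : ℕ) (j : ℤ) :
    1 - (2 * L + 2) / (b : ℝ) ^ (k + 1) ≤
      (measure ha hab).real (cylinder j (powWord a b k L)) * (block a b k).length := by
  set h := (block a b k).length with hh
  set w := powWord a b k L
  set c : ℝ := (b : ℝ) ^ (k + 1) with hc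
  have hh1 : (1 : ℝ) ≤ h := by exact_mod_cast length_pos a b k
  have hb : 0 < b := by omega
  have hcpos : 0 < c := by positivity
  have hlim := (tendsto_density ha hab j w).mul_const (h : ℝ)
  refine ge_of_tendsto hlim ?_
  filter_upwards [eventually_ge_atTop (k + 1)] with i hi
  have h1 := occ_le_density_mul a b i w
  have h2 := occ_mul_le ha hab (List.ofFn w) hi
  have h3 := le_occ_block_succ hab k L
  set H := (block a b i).length with hH
  have hH1 : (1 : ℝ) ≤ H := by exact_mod_cast length_pos a b i
  rw [length_succ hab] at h2
  have h2' : (occ (List.ofFn w) (block a b (k + 1)) : ℝ) * (H + 1) ≤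
      occ (List.ofFn w) (block a b i) * (c * h + 1 + 1) := by
    rw [hc, hh]; exact_mod_cast h2
  have h3' : c ≤ occ (List.ofFn w) (block a b (k + 1)) + 2 * L := by
    rw [hc]; exact_mod_cast h3
  have hd := (density_bd a b i w).1
  have h4 : (c - 2 * L) * H ≤ density a b i w * H * (c * h + 2) := by
    rcases le_or_gt c (2 * L) with hcL | hcL
    · exact (mul_nonpos_of_nonpos_of_nonneg (by linarith) (by linarith)).trans (by positivity)
    calc (c - 2 * L) * H ≤ occ (List.ofFn w) (block a b (k + 1)) * (H + 1) := by
          apply mul_le_mul <;> linarith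
      _ ≤ occ (List.ofFn w) (block a b i) * (c * h + 2) := by linarith
      _ ≤ _ := by gcongr
  have h5 : c - 2 * L ≤ density a b i w * (c * h + 2) := by nlinarith
  have h6 : 1 - (2 * L + 2) / c = (c - 2 * L - 2) / c := by field_simp; ring
  rw [h6, div_le_iff₀ hcpos]
  have hd1 := (density_bd a b i w).2
  nlinarith

/-! ### The weak topology -/

section Automorphisms

variable {X : Type*} [MeasurableSpace X] {μ : Measure X}

theorem autGroup.image_mul (e f : autGroup μ) (A : MeasuredSets μ) :
    autGroup.image (e * f) A = autGroup.image e (autGroup.image f A) :=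
  Subtype.ext (image_comp e.1 f.1 (A : Set X))

theorem autGroup.measure_image (e : autGroup μ) {A : Set X} (hA : MeasurableSet A) :
    μ (e.1 '' A) = μ A := by
  rw [Equiv.image_eq_preimage_symm]
  exact e.2.2.measure_preimage hA.nullMeasurableSet

theorem autGroup.edist_image (e : autGroup μ) (A B : MeasuredSets μ) :
    edist (autGroup.image e A) (autGroup.image e B) = edist A B := by
  rw [MeasuredSets.edist_def, MeasuredSets.edist_def]
  change μ ((e.1 '' A) ∆ (e.1 '' B)) = _
  rw [← image_symmDiff e.1.injective]
  exact autGroup.measure_image e (A.2.symmDiff B.2)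

theorem autGroup.continuous_image (A : MeasuredSets μ) :
    Continuous fun e : autGroup μ => autGroup.image e A :=
  continuous_iInf_dom (i := A) continuous_induced_dom

theorem autGroup.tendsto_iff {ι : Type*} {l : Filter ι} {u : ι → autGroup μ} {e : autGroup μ} :
    Tendsto u l (𝓝 e) ↔
      ∀ A, Tendsto (fun i => autGroup.image (u i) A) l (𝓝 (autGroup.image e A)) := by
  simp only [nhds_iInf, nhds_induced, tendsto_iInf, tendsto_comap_iff, Function.comp_def]

/-- Transformations that agree almost everywhere are topologically indistinguishable. -/
theorem autGroup.inseparable_of_mk_eq {e f : autGroup μ} (h : (e : Aut μ) = f) :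
    Inseparable e f := by
  have h1 : ∀ᵐ x ∂μ, (e⁻¹ * f)⁻¹.1 x = x := inv_mem (QuotientGroup.eq.1 h)
  have h2 := e.2.2.quasiMeasurePreserving.ae h1
  have key : ∀ A, 𝓝 (autGroup.image e A) = 𝓝 (autGroup.image f A) := by
    intro A
    refine EMetric.inseparable_iff.2 ?_
    rw [MeasuredSets.edist_def, measure_symmDiff_eq_zero_iff]
    change (e.1 '' A : Set X) =ᵐ[μ] (f.1 '' A : Set X)
    rw [Equiv.image_eq_preimage_symm, Equiv.image_eq_preimage_symm]
    refine eventuallyEq_set.2 ?_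
    filter_upwards [h2] with x hx
    have hx' : f.1.symm (e.1 (e.1.symm x)) = e.1.symm x := hx
    rw [Equiv.apply_symm_apply] at hx'
    rw [mem_preimage, mem_preimage, hx']
  simp only [Inseparable, nhds_iInf, nhds_induced, key]

theorem autGroup.mem_of_mk_mem_image {U : Set (autGroup μ)} (hU : IsOpen U) {e : autGroup μ}
    (h : (e : Aut μ) ∈ (QuotientGroup.mk '' U : Set (Aut μ))) : e ∈ U := by
  obtain ⟨f, hf, hfe⟩ := h
  exact ((autGroup.inseparable_of_mk_eq hfe).mem_open_iff hU).1 hf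

theorem autGroup.isOpen_image_mk {U : Set (autGroup μ)} (hU : IsOpen U) :
    IsOpen (QuotientGroup.mk '' U : Set (Aut μ)) := by
  rw [← (QuotientGroup.isQuotientMap_mk (nullGroup μ)).isOpen_preimage]
  convert hU
  ext e
  exact ⟨autGroup.mem_of_mk_mem_image hU, fun h => ⟨e, h, rfl⟩⟩

/-! ### Approximate towers -/

/-- The transformations with an approximate tower of accuracy `ε` on whose levels `W` is constant:
`h` disjoint sets `F_0, …, F_{h-1}` that cover the space up to measure `ε`, such that `e (F_i)`
differs from `F_{i+1}` on a set of measure less than `ε / h ^ 2`. The sets are not required to be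
exact images of each other, which makes the condition open in `e`. -/
def approxTower (μ : Measure X) {ι : Type*} (W : X → ι) (ε : ℝ≥0∞) : Set (autGroup μ) :=
  {e | ∃ (h : ℕ) (F : ℕ → MeasuredSets μ), 0 < h ∧
    (∀ i < h, ∀ j < h, i ≠ j → Disjoint (F i : Set X) (F j)) ∧
    (∀ i < h, ∃ c, ∀ x ∈ (F i : Set X), W x = c) ∧
    μ (⋃ i < h, (F i : Set X))ᶜ < ε ∧
    ∀ i ∈ Finset.range (h - 1), edist (autGroup.image e (F i)) (F (i + 1)) < ε / (h * h)}

theorem isOpen_approxTower {ι : Type*} (W : X → ι) (ε : ℝ≥0∞) : IsOpen (approxTower μ W ε) := by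
  simp only [approxTower, ofPred_exists, ofPred_and]
  refine isOpen_iUnion fun h => isOpen_iUnion fun F => isOpen_const.inter <| isOpen_const.inter <|
    isOpen_const.inter <| isOpen_const.inter ?_
  simp only [ofPred_forall]
  exact isOpen_biInter_finset fun i _ =>
    isOpen_lt ((autGroup.continuous_image _).edist continuous_const) continuous_const

/-- An approximate tower contains an exact one: the base consists of the points of `F_0` whose
orbit follows `F_0, F_1, …` up to the top level. -/
theorem exists_tower_of_mem_approxTower {ι : Type*} {W : X → ι} {ε : ℝ≥0∞} {e : autGroup μ}
    (he : e ∈ approxTower μ W ε) :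
    ∃ (F : Set X) (h : ℕ), MeasurableSet F ∧ 0 < h ∧
      (∀ i < h, ∀ j < h, i ≠ j → Disjoint (e.1^[i] '' F) (e.1^[j] '' F)) ∧
      (∀ i < h, ∃ c, ∀ x ∈ e.1^[i] '' F, W x = c) ∧
      μ (⋃ i < h, e.1^[i] '' F)ᶜ ≤ ε + ε := by
  obtain ⟨h, F, hh, hdisj, hW, hcov, hstep⟩ := he
  let B : Set X := {x | ∀ i < h, e.1^[i] x ∈ (F i : Set X)}
  have hBF : ∀ i < h, e.1^[i] '' B ⊆ F i := by
    rintro i hi _ ⟨x, hx, rfl⟩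
    exact hx i hi
  have hmeas : ∀ i, Measurable e.1^[i] := fun i => e.2.1.measurable.iterate i
  have hB : MeasurableSet B := by
    have : B = ⋂ i, ⋂ _ : i < h, e.1^[i] ⁻¹' (F i) := by ext; simp [B]
    rw [this]
    exact .iInter fun i => .iInter fun _ => hmeas i (F i).2
  let D : ℕ → Set X := fun j => (e.1 '' (F j)) ∆ (F (j + 1))
  have hD : ∀ j, MeasurableSet (D j) := fun j => (autGroup.image e (F j)).2.symmDiff (F (j + 1)).2
  let G : Set X := ⋃ j ∈ Finset.range (h - 1), e.1^[j + 1] ⁻¹' (D j)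
  have hG : MeasurableSet G := Finset.measurableSet_biUnion _ fun j _ => hmeas _ (hD j)
  have hGle : μ G ≤ h * (ε / (h * h)) := by
    calc μ G ≤ ∑ j ∈ Finset.range (h - 1), μ (e.1^[j + 1] ⁻¹' (D j)) :=
          measure_biUnion_finset_le _ _
      _ ≤ ∑ j ∈ Finset.range (h - 1), ε / (h * h) := by
          refine Finset.sum_le_sum fun j hj => ?_
          rw [(e.2.1.iterate (j + 1)).measure_preimage (hD j).nullMeasurableSet]
          exact (hstep j hj).le
      _ = (h - 1 : ℕ) * (ε / (h * h)) := by simp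
      _ ≤ h * (ε / (h * h)) := by gcongr; omega
  -- Outside `G` an orbit lies in `F_j` at time `j` for all `j < h` or for none.
  have hfollow : ∀ x, x ∉ G → ∀ j < h, (e.1^[j] x ∈ (F j : Set X) ↔ x ∈ (F 0 : Set X)) := by
    intro x hx j
    induction j with
    | zero => simp
    | succ j ih =>
      intro hj
      rw [← ih (by omega)]
      simp only [G, mem_iUnion, mem_preimage, not_exists] at hx
      have h1 := hx j (Finset.mem_range.2 (by omega))
      simp only [D, Function.iterate_succ_apply', mem_symmDiff,
        e.1.injective.mem_set_image] at h1 ⊢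
      tauto
  have hlost : ∀ i < h, (F i : Set X) \ e.1^[i] '' B ⊆ e.1^[i] '' G := by
    rintro i hi y ⟨hy, hyB⟩
    obtain ⟨x, rfl⟩ := (e.1.surjective.iterate i) y
    refine ⟨x, ?_, rfl⟩
    by_contra hx
    exact hyB ⟨x, fun j hj => (hfollow x hx j hj).2 ((hfollow x hx i hi).1 hy), rfl⟩
  have hGi : ∀ i, μ (e.1^[i] '' G) = μ G := by
    intro i
    rw [image_eq_preimage_of_inverse (e.1.leftInverse_symm.iterate i)
      (e.1.rightInverse_symm.iterate i)]
    exact (e.2.2.iterate i).measure_preimage hG.nullMeasurableSet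
  refine ⟨B, h, hB, hh, fun i hi j hj hij => (hdisj i hi j hj hij).mono (hBF i hi) (hBF j hj),
    fun i hi => ?_, ?_⟩
  · obtain ⟨c, hc⟩ := hW i hi
    exact ⟨c, fun x hx => hc x (hBF i hi hx)⟩
  · have hsub : (⋃ i < h, e.1^[i] '' B)ᶜ ⊆
        (⋃ i < h, (F i : Set X))ᶜ ∪ ⋃ i ∈ Finset.range h, e.1^[i] '' G := by
      intro y hy
      by_cases hyF : y ∈ ⋃ i < h, (F i : Set X)
      · right
        simp only [mem_iUnion, exists_prop] at hyF
        obtain ⟨i, hi, hyi⟩ := hyF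
        refine mem_biUnion (Finset.mem_coe.2 (Finset.mem_range.2 hi)) (hlost i hi ⟨hyi, fun h => ?_⟩)
        exact hy (mem_biUnion hi h)
      · exact Or.inl hyF
    calc μ (⋃ i < h, e.1^[i] '' B)ᶜ
        ≤ μ (⋃ i < h, (F i : Set X))ᶜ + μ (⋃ i ∈ Finset.range h, e.1^[i] '' G) :=
          (measure_mono hsub).trans (measure_union_le _ _)
      _ ≤ μ (⋃ i < h, (F i : Set X))ᶜ + ε := by
          gcongr
          refine (measure_biUnion_finset_le _ _).trans ?_
          simp only [hGi, Finset.sum_const, Finset.card_range, nsmul_eq_mul]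
          calc h * μ G ≤ h * (h * (ε / (h * h))) := by gcongr
            _ = (h * h) * (ε / (h * h)) := by rw [mul_assoc]
            _ ≤ ε := ENNReal.mul_div_le
      _ ≤ ε + ε := by gcongr

/-- If the functions `W N` determine all finite partitions up to small sets, then a transformation
with approximate towers for all of them is rank one. -/
theorem isRankOne_of_mem_approxTower [IsProbabilityMeasure μ] {ι : ℕ → Type*}
    [∀ N, MeasurableSpace (ι N)] [∀ N, DiscreteMeasurableSpace (ι N)] {W : ∀ N, X → ι N} (hW : ∀ N, Measurable (W N))
    (hgen : ∀ (n : ℕ) (P : X → Fin n), Measurable P → ∀ ε : ℝ≥0∞, 0 < ε →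
      ∃ (N : ℕ) (g : ι N → Fin n), μ {x | P x ≠ g (W N x)} < ε)
    {e : autGroup μ} (he : ∀ N j : ℕ, e ∈ approxTower μ (W N) (j : ℝ≥0∞)⁻¹) :
    IsRankOne e.1 μ := by
  classical
  intro n P hP ε hε
  obtain ⟨x₀⟩ : Nonempty X := nonempty_of_isProbabilityMeasure μ
  obtain ⟨N, g, hg⟩ := hgen n P hP (ε / 2) (ENNReal.half_pos hε.ne')
  obtain ⟨j, hj⟩ := ENNReal.exists_inv_nat_lt (ENNReal.half_pos (ENNReal.half_pos hε.ne').ne').ne'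
  obtain ⟨F, h, hF, hh, hdisj, hconst, hcov⟩ := exists_tower_of_mem_approxTower (he N j)
  have hcov' : μ (⋃ i < h, e.1^[i] '' F)ᶜ < ε / 2 :=
    hcov.trans_lt ((ENNReal.add_lt_add hj hj).trans_eq (ENNReal.add_halves _))
  set U := ⋃ i < h, e.1^[i] '' F with hU
  have hUm : MeasurableSet U := by
    refine .iUnion fun i => .iUnion fun _ => ?_
    rw [image_eq_preimage_of_inverse (e.1.leftInverse_symm.iterate i)
      (e.1.rightInverse_symm.iterate i)]
    exact e.2.2.measurable.iterate i hF
  refine ⟨F, h, fun x => if x ∈ U then g (W N x) else P x₀, hF, hh, hdisj,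
    hcov'.trans_le ENNReal.half_le_self, ?_, fun i hi => ?_, ⟨P x₀, fun x hx => if_neg hx⟩, ?_⟩
  · exact Measurable.ite hUm ((Measurable.of_discrete (f := g)).comp (hW N)) measurable_const
  · obtain ⟨c, hc⟩ := hconst i hi
    refine ⟨g c, fun x hx => ?_⟩
    have hxU : x ∈ U := mem_biUnion (show i ∈ {i | i < h} from hi) hx
    simp only [if_pos hxU, hc x hx]
  · have hsub : {x | P x ≠ if x ∈ U then g (W N x) else P x₀} ⊆ {x | P x ≠ g (W N x)} ∪ Uᶜ := by
      intro x hx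
      by_cases hxU : x ∈ U
      · left; simpa [hxU] using hx
      · exact Or.inr hxU
    calc _ ≤ μ {x | P x ≠ g (W N x)} + μ Uᶜ := (measure_mono hsub).trans (measure_union_le _ _)
      _ < ε / 2 + ε / 2 := ENNReal.add_lt_add hg hcov'
      _ = ε := ENNReal.add_halves ε

end Automorphisms

/-! ### Windows -/

/-- The coordinates of `x` in `[-N, N]`, with the coordinate `n` stored at the index `N + n`. -/
def window (a b N : ℕ) (x : shiftSpace a b) : Fin (2 * N + 1) → Fin 2 := fun i => x.1 (-N + i)

theorem window_preimage_singleton (a b N : ℕ) (w : Fin (2 * N + 1) → Fin 2) :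
    window a b N ⁻¹' {w} = cylinder (-N) w := by
  ext x
  simp [window, cylinder, Occurs, funext_iff]

theorem measurable_window (a b N : ℕ) : Measurable (window a b N) :=
  measurable_pi_lambda _ fun i => (measurable_pi_apply (-(N : ℤ) + i)).comp measurable_subtype_coe

theorem exists_window_preimage_eq {a b N M : ℕ} (h : N ≤ M) (S : Set (Fin (2 * N + 1) → Fin 2)) :
    ∃ S', window a b N ⁻¹' S = window a b M ⁻¹' S' := by
  refine ⟨{w | (fun i : Fin (2 * N + 1) => w ⟨M - N + i, by omega⟩) ∈ S}, ?_⟩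
  ext x
  have : window a b N x = fun i : Fin (2 * N + 1) => window a b M x ⟨M - N + i, by omega⟩ := by
    ext i
    have hi : -(N : ℤ) + i = -M + (M - N + i : ℕ) := by omega
    simp only [window, hi]
  simp only [mem_preimage, mem_ofPred_eq, this]

theorem isSetRing_window (a b : ℕ) :
    IsSetRing {s | ∃ (N : ℕ) (S : Set (Fin (2 * N + 1) → Fin 2)), s = window a b N ⁻¹' S} := by
  refine ⟨⟨0, ∅, by simp⟩, ?_, ?_⟩
  all_goals
    rintro _ _ ⟨N, S, rfl⟩ ⟨N', S', rfl⟩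
    obtain ⟨S₁, h₁⟩ := exists_window_preimage_eq (a := a) (b := b) (le_max_left N N') S
    obtain ⟨S₂, h₂⟩ := exists_window_preimage_eq (a := a) (b := b) (le_max_right N N') S'
    rw [h₁, h₂]
  · exact ⟨_, S₁ ∪ S₂, rfl⟩
  · exact ⟨_, S₁ \ S₂, rfl⟩

theorem exists_window_symmDiff_lt {a b : ℕ} (μ : Measure (shiftSpace a b)) [IsFiniteMeasure μ]
    {A : Set (shiftSpace a b)} (hA : MeasurableSet A) {ε : ℝ≥0∞} (hε : 0 < ε) :
    ∃ (N : ℕ) (S : Set (Fin (2 * N + 1) → Fin 2)), μ ((window a b N ⁻¹' S) ∆ A) < ε := by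
  have hgen : (inferInstance : MeasurableSpace (shiftSpace a b)) = MeasurableSpace.generateFrom
      {s | ∃ (N : ℕ) (S : Set (Fin (2 * N + 1) → Fin 2)), s = window a b N ⁻¹' S} := by
    apply le_antisymm
    · refine (generateFrom_centralCylinders a b).le.trans (MeasurableSpace.generateFrom_mono ?_)
      rintro _ ⟨N, w, rfl⟩
      exact ⟨N, {w}, (window_preimage_singleton a b N w).symm⟩
    · refine MeasurableSpace.generateFrom_le ?_
      rintro _ ⟨N, S, rfl⟩
      exact measurable_window a b N S.toFinite.measurableSet
  obtain ⟨_, ⟨N, S, rfl⟩, h⟩ := exists_measure_symmDiff_lt_of_generateFrom_isSetRing (μ := μ)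
    (isSetRing_window a b) ⟨{univ}, by simp, by simpa using ⟨0, univ, by simp⟩, by simp⟩ hgen hA hε
  exact ⟨N, S, h⟩

/-- Every finite partition is approximated by partitions according to a window. -/
theorem exists_window_approx {a b : ℕ} (μ : Measure (shiftSpace a b)) [IsProbabilityMeasure μ]
    {n : ℕ} {P : shiftSpace a b → Fin n} (hP : Measurable P) {ε : ℝ≥0∞} (hε : 0 < ε) :
    ∃ (N : ℕ) (g : (Fin (2 * N + 1) → Fin 2) → Fin n), μ {x | P x ≠ g (window a b N x)} < ε := by
  classical
  obtain ⟨x₀⟩ : Nonempty (shiftSpace a b) := nonempty_of_isProbabilityMeasure μ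
  obtain ⟨δ, hδ, hsum⟩ := ENNReal.exists_pos_sum_of_countable' hε.ne' (Fin n)
  choose N S hS using fun c : Fin n =>
    exists_window_symmDiff_lt μ (hP (measurableSet_singleton c)) (hδ c)
  let M := Finset.univ.sup N
  choose S' hS' using fun c : Fin n => exists_window_preimage_eq (a := a) (b := b)
    (Finset.le_sup (Finset.mem_univ c) : N c ≤ M) (S c)
  refine ⟨M, fun w => if h : ∃ c, w ∈ S' c then h.choose else P x₀, ?_⟩
  refine (measure_mono (t := ⋃ c, (window a b (N c) ⁻¹' S c) ∆ (P ⁻¹' {c})) ?_).trans_lt ?_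
  · intro x hx
    by_contra hx'
    have hc : ∀ c, window a b M x ∈ S' c ↔ P x = c := by
      intro c
      have h1 : x ∉ (window a b (N c) ⁻¹' S c) ∆ (P ⁻¹' {c}) := fun h => hx' (mem_iUnion.2 ⟨c, h⟩)
      rw [hS' c, mem_symmDiff] at h1
      simp only [mem_preimage, mem_singleton_iff] at h1
      tauto
    have hex : ∃ c, window a b M x ∈ S' c := ⟨P x, (hc _).2 rfl⟩
    refine hx ?_
    simp only [dif_pos hex]
    exact (hc _).1 hex.choose_spec
  · exact (measure_iUnion_le _).trans_lt
      ((ENNReal.tsum_le_tsum fun c => (hS c).le).trans_lt hsum)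

/-! ### Towers for the powers of the shift -/

/-- The shift as an automorphism of the measure space. -/
def shiftAut {a b : ℕ} (ha : 1 ≤ a) (hab : a < b) : autGroup (measure ha hab) :=
  ⟨shift a b, measurePreserving_shift ha hab, measurePreserving_shift_symm ha hab⟩

theorem shiftAut_zpow_apply {a b : ℕ} (ha : 1 ≤ a) (hab : a < b) (n : ℤ) (x : shiftSpace a b)
    (t : ℤ) : ((shiftAut ha hab ^ n).1 x).1 t = x.1 (t + n) := by
  rw [Subgroup.coe_zpow]
  change (((shift a b) ^ n) x).1 t = _
  induction n using Int.induction_on generalizing t with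
  | zero => simp
  | succ n ih =>
    rw [add_comm (n : ℤ) 1, zpow_one_add, ← add_assoc]
    exact ih (t + 1)
  | pred n ih =>
    rw [sub_eq_neg_add, zpow_add, zpow_neg_one, ← add_assoc]
    exact ih (t - 1)

theorem shiftAut_zpow_image_cylinder {a b : ℕ} (ha : 1 ≤ a) (hab : a < b) (n j : ℤ) {l : ℕ}
    (w : Fin l → Fin 2) : (shiftAut ha hab ^ n).1 '' cylinder j w = cylinder (j - n) w := by
  rw [Equiv.image_eq_preimage_symm]
  ext x
  have h : (shiftAut ha hab ^ n).1.symm x = (shiftAut ha hab ^ (-n)).1 x := by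
    rw [zpow_neg]; rfl
  simp only [mem_preimage, h, cylinder, mem_ofPred_eq, Occurs, shiftAut_zpow_apply]
  refine forall_congr' fun i => ?_
  rw [show j + (i : ℤ) + -n = j - n + i by ring]

theorem apply_of_mem_cylinder_powWord {a b k L : ℕ} {j : ℤ} {x : shiftSpace a b}
    (hx : x ∈ cylinder j (powWord a b k L)) {n : ℕ} (hn : n < L * (block a b k).length) {t : ℤ}
    (ht : t = j + n) : x.1 t = periodicSeq a b k n := by
  rw [ht]
  exact hx ⟨n, hn⟩

/-- The `i`-th level of the tower of `T ^ m` over `B_k`: the points in which the word `B_k ^ (m + 3)`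
occurs at `-N - m i`. The length of the word ensures that the window `[-N, N]` and its translate by
`|B_k|` lie inside this occurrence for all `i < |B_k|`. -/
def towerLevel (a b k N m i : ℕ) : Set (shiftSpace a b) :=
  cylinder (-N - m * i) (powWord a b k (m + 3))

theorem measurableSet_towerLevel (a b k N m i : ℕ) : MeasurableSet (towerLevel a b k N m i) :=
  measurableSet_cylinder _ _

theorem image_towerLevel {a b : ℕ} (ha : 1 ≤ a) (hab : a < b) (k N m i : ℕ) :
    (shiftAut ha hab ^ (m : ℤ)).1 '' towerLevel a b k N m i = towerLevel a b k N m (i + 1) := by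
  rw [towerLevel, shiftAut_zpow_image_cylinder, towerLevel]
  congr 1
  push_cast
  ring

/-- If `m` is prime to `|B_k|`, the levels are disjoint: in a common point of two of them the word
`B_k` would occur inside a power of `B_k` at a place which is not a multiple of `|B_k|`. -/
theorem disjoint_towerLevel {a b : ℕ} (hab : a < b) {k N m : ℕ}
    (hm : m.Coprime (block a b k).length) {i j : ℕ} (hi : i < (block a b k).length)
    (hj : j < (block a b k).length) (hij : i ≠ j) :
    Disjoint (towerLevel a b k N m i) (towerLevel a b k N m j) := by
  wlog hlt : i < j generalizing i j
  · exact (this hj hi hij.symm (by omega)).symm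
  set h := (block a b k).length with hh
  have hpos : 0 < h := length_pos a b k
  refine Set.disjoint_left.2 fun x hxi hxj => ?_
  set s := m * (j - i) with hs
  have hsh : s ≤ m * h := Nat.mul_le_mul le_rfl (by omega)
  have hloc : ∀ t : ℕ, t < h → periodicSeq a b k (t + s : ℕ) = periodicSeq a b k t := by
    intro t ht
    rw [← apply_of_mem_cylinder_powWord hxj (n := t + s) (t := -N - m * i + t)
        (by rw [← hh]; nlinarith),
      ← apply_of_mem_cylinder_powWord hxi (n := t) (t := -N - m * i + t)
        (by rw [← hh]; nlinarith) rfl]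
    push_cast [hs, Nat.cast_sub hlt.le]
    ring
  have hper : Function.Periodic (periodicSeq a b k) (s : ℤ) := by
    intro n
    have hP : Function.Periodic (periodicSeq a b k) (h : ℤ) := periodicSeq_add a b k
    have h0 : (0 : ℤ) < h := by exact_mod_cast hpos
    obtain ⟨t, ht⟩ := Int.eq_ofNat_of_zero_le (Int.emod_nonneg n h0.ne')
    have hth : t < h := by have := Int.emod_lt_of_pos n h0; omega
    have hn : n = t + n / h * h := by rw [← ht]; have := Int.emod_add_mul_ediv n h; linarith
    have h1 : Function.Periodic (periodicSeq a b k) (n / h * h) := hP.int_mul (n / h)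
    rw [hn, add_right_comm, h1, h1]
    exact_mod_cast hloc t hth
  have hdvd : h ∣ m * (j - i) := by exact_mod_cast length_dvd_of_periodic hab k hper
  have := Nat.le_of_dvd (by omega) (hm.symm.dvd_of_dvd_mul_left hdvd)
  omega

theorem window_eq_of_mem_towerLevel {a b k N m i : ℕ} (hN : 2 * N < (block a b k).length)
    (hi : i < (block a b k).length) {x : shiftSpace a b} (hx : x ∈ towerLevel a b k N m i) :
    window a b N x = fun t : Fin (2 * N + 1) => periodicSeq a b k (m * i + t : ℕ) := by
  ext t
  have ht := t.2
  have := Nat.mul_le_mul (le_refl m) hi.le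
  rw [window, apply_of_mem_cylinder_powWord hx (n := m * i + t) (by nlinarith)
    (by push_cast; ring)]

theorem window_shift_eq_of_mem_towerLevel {a b : ℕ} (ha : 1 ≤ a) (hab : a < b) {k N m i : ℕ}
    (hN : 2 * N < (block a b k).length) (hi : i < (block a b k).length) {x : shiftSpace a b}
    (hx : x ∈ towerLevel a b k N m i) :
    window a b N ((shiftAut ha hab ^ ((block a b k).length : ℤ)).1 x) = window a b N x := by
  rw [window_eq_of_mem_towerLevel hN hi hx]
  ext t
  have ht := t.2
  have := Nat.mul_le_mul (le_refl m) hi.le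
  rw [window, shiftAut_zpow_apply, ← periodicSeq_add,
    apply_of_mem_cylinder_powWord hx (n := m * i + t + (block a b k).length) (by nlinarith)
    (by push_cast; ring)]
  push_cast
  rfl

theorem measure_compl_towerLevel_le {a b : ℕ} (ha : 1 ≤ a) (hab : a < b) {k N m : ℕ}
    (hm : m.Coprime (block a b k).length) :
    measure ha hab (⋃ i < (block a b k).length, towerLevel a b k N m i)ᶜ ≤
      ENNReal.ofReal ((2 * (m + 3 : ℕ) + 2) / (b : ℝ) ^ (k + 1)) := by
  set h := (block a b k).length with hh
  have hpos : (0 : ℝ) < h := by exact_mod_cast length_pos a b k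
  have hU : (⋃ i < h, towerLevel a b k N m i) = ⋃ i ∈ Finset.range h, towerLevel a b k N m i := by
    simp
  have hUm : MeasurableSet (⋃ i ∈ Finset.range h, towerLevel a b k N m i) :=
    Finset.measurableSet_biUnion _ fun i _ => measurableSet_towerLevel a b k N m i
  rw [hU, ← ofReal_measureReal, probReal_compl_eq_one_sub hUm]
  refine ENNReal.ofReal_le_ofReal ?_
  rw [measureReal_biUnion_finset (fun i hi j hj hij => disjoint_towerLevel hab hm
    (by simpa using hi) (by simpa using hj) hij) fun i _ => measurableSet_towerLevel a b k N m i]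
  have h1 : ∀ i ∈ Finset.range h, (1 - (2 * (m + 3 : ℕ) + 2) / (b : ℝ) ^ (k + 1)) / h ≤
      (measure ha hab).real (towerLevel a b k N m i) := fun i _ => by
    rw [div_le_iff₀ hpos]
    exact measureReal_cylinder_powWord ha hab k (m + 3) _
  have h2 := Finset.sum_le_sum h1
  rw [Finset.sum_const, Finset.card_range, nsmul_eq_mul, mul_div_cancel₀ _ hpos.ne'] at h2
  linarith

theorem tendsto_towerLevel_error {a b : ℕ} (ha : 1 ≤ a) (hab : a < b) (m : ℕ) :
    Tendsto (fun k : ℕ => ENNReal.ofReal ((2 * (m + 3 : ℕ) + 2) / (b : ℝ) ^ (k + 1)))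
      atTop (𝓝 0) := by
  have hb : (1 : ℝ) < b := by exact_mod_cast (by omega : 1 < b)
  have := ((tendsto_pow_atTop_atTop_of_one_lt hb).comp (tendsto_add_atTop_nat 1)).const_div_atTop
    (2 * ((m + 3 : ℕ) : ℝ) + 2)
  simpa using ENNReal.tendsto_ofReal this

theorem eventually_lt_length {a b : ℕ} (ha : 1 ≤ a) (hab : a < b) (n : ℕ) :
    ∀ᶠ k in atTop, n < (block a b k).length := by
  filter_upwards [eventually_ge_atTop n] with k hk
  exact (hk.trans_lt Nat.lt_two_pow_self).trans_le (length_ge ha hab k)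

theorem shiftAut_pow_mem_approxTower {a b : ℕ} (ha : 1 ≤ a) (hab : a < b) {m : ℕ} (hm : m ≠ 0)
    (N : ℕ) {ε : ℝ≥0∞} (hε : 0 < ε) :
    shiftAut ha hab ^ (m : ℤ) ∈ approxTower (measure ha hab) (window a b N) ε := by
  obtain ⟨K, hK⟩ := eventually_atTop.1 ((eventually_lt_length ha hab (2 * N)).and
    ((tendsto_towerLevel_error ha hab m).eventually_lt_const hε))
  obtain ⟨k, hk, hcop⟩ := exists_coprime_length hab hm K
  obtain ⟨hN, herr⟩ := hK k hk
  have hpos := length_pos a b k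
  refine ⟨(block a b k).length,
    fun i => ⟨towerLevel a b k N m i, measurableSet_towerLevel a b k N m i⟩, hpos, fun i hi j hj hij => disjoint_towerLevel hab hcop hi hj hij,
    fun i hi => ⟨_, fun x hx => window_eq_of_mem_towerLevel hN hi hx⟩,
    (measure_compl_towerLevel_le ha hab hcop).trans_lt herr, fun i _ => ?_⟩
  have : autGroup.image (shiftAut ha hab ^ (m : ℤ))
      (⟨towerLevel a b k N m i, measurableSet_towerLevel a b k N m i⟩ :
        MeasuredSets (measure ha hab)) =
      ⟨towerLevel a b k N m (i + 1), measurableSet_towerLevel a b k N m (i + 1)⟩ :=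
    Subtype.ext (image_towerLevel ha hab k N m i)
  exact ((congrArg (edist · _) this).trans (edist_self _)).trans_lt
    (ENNReal.div_pos hε.ne' (ENNReal.mul_ne_top (ENNReal.natCast_ne_top _)
      (ENNReal.natCast_ne_top _)))

/-! ### Rigidity -/

/-- The times `|B_k|` are rigidity times of the shift: up to a small set, `x` is periodic with
period `|B_k|` around the origin. -/
theorem tendsto_image_shiftAut_length {a b : ℕ} (ha : 1 ≤ a) (hab : a < b)
    (A : MeasuredSets (measure ha hab)) :
    Tendsto (fun k => autGroup.image (shiftAut ha hab ^ ((block a b k).length : ℤ)) A)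
      atTop (𝓝 A) := by
  rw [tendsto_iff_edist_tendsto_0, ENNReal.tendsto_nhds_zero]
  intro ε hε
  have hε2 : 0 < ε / 2 := ENNReal.half_pos hε.ne'
  have hε4 : 0 < ε / 2 / 2 := ENNReal.half_pos hε2.ne'
  obtain ⟨N, S, hS⟩ := exists_window_symmDiff_lt (measure ha hab) A.2 hε4
  filter_upwards [eventually_lt_length ha hab (2 * N),
    (tendsto_towerLevel_error ha hab 1).eventually_lt_const hε2] with k hN herr
  set e := shiftAut ha hab ^ ((block a b k).length : ℤ) with he
  let B : MeasuredSets (measure ha hab) :=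
    ⟨window a b N ⁻¹' S, measurable_window a b N S.toFinite.measurableSet⟩
  have hBA : edist B A < ε / 2 / 2 := hS
  have hU : MeasurableSet (⋃ i < (block a b k).length, towerLevel a b k N 1 i)ᶜ :=
    (MeasurableSet.iUnion fun i => .iUnion fun _ => measurableSet_towerLevel a b k N 1 i).compl
  -- On the tower, `x` and `e x` have the same window, so only points outside it contribute.
  have hB : edist (autGroup.image e B) B ≤ ε / 2 := by
    rw [MeasuredSets.edist_def]
    refine (measure_mono
      (t := e.1 '' (⋃ i < (block a b k).length, towerLevel a b k N 1 i)ᶜ) ?_).trans ?_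
    · intro y hy
      obtain ⟨x, rfl⟩ := e.1.surjective y
      refine ⟨x, fun hx => ?_, rfl⟩
      simp only [mem_iUnion, exists_prop] at hx
      obtain ⟨i, hi, hxi⟩ := hx
      have hw := window_shift_eq_of_mem_towerLevel ha hab hN hi hxi
      have h1 : e.1 x ∈ (autGroup.image e B : Set (shiftSpace a b)) ↔ window a b N x ∈ S :=
        e.1.injective.mem_set_image
      have h2 : e.1 x ∈ (B : Set (shiftSpace a b)) ↔ window a b N x ∈ S := by
        rw [← hw]; exact Iff.rfl
      rw [mem_symmDiff, h1, h2] at hy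
      tauto
    · rw [autGroup.measure_image e hU]
      exact (measure_compl_towerLevel_le ha hab (Nat.coprime_one_left _)).trans herr.le
  calc edist (autGroup.image e A) A
      ≤ edist (autGroup.image e A) (autGroup.image e B) + edist (autGroup.image e B) B +
          edist B A := edist_triangle4 _ _ _ _
    _ ≤ ε / 2 / 2 + ε / 2 + ε / 2 / 2 := by
        rw [autGroup.edist_image, edist_comm]
        gcongr
    _ = ε := by rw [add_right_comm, ENNReal.add_halves, ENNReal.add_halves]

theorem tendsto_shiftAut_zpow_add_length {a b : ℕ} (ha : 1 ≤ a) (hab : a < b) (n : ℤ) :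
    Tendsto (fun k => shiftAut ha hab ^ (((block a b k).length : ℤ) + n)) atTop
      (𝓝 (shiftAut ha hab ^ n)) := by
  refine autGroup.tendsto_iff.2 fun A => ?_
  simp only [zpow_add, autGroup.image_mul]
  exact tendsto_image_shiftAut_length ha hab _

end DJR

/-! ### A dense `Gδ` set of rank one transformations -/

open DJR MeasureTheory Filter Topology Set
open scoped ENNReal

theorem mainTheorem4 (a b : ℕ) (ha : 1 ≤ a) (hab : a < b) :
    ∃ R : Set (DJR.weakClosure (DJR.genMap ha hab)),
      IsGδ R ∧ Dense R ∧
        ∀ S ∈ R, DJR.IsRankOneAut (S : DJR.Aut (DJR.measure ha hab)) := by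
  let U : ℕ → ℕ → Set (autGroup (measure ha hab)) := fun N j =>
    approxTower (measure ha hab) (window a b N) (j : ℝ≥0∞)⁻¹
  have hU : ∀ N j, IsOpen (U N j) := fun N j => isOpen_approxTower _ _
  have hpow : ∀ n : ℤ, genMap ha hab ^ n = (shiftAut ha hab ^ n : autGroup (measure ha hab)) :=
    fun n => rfl
  refine ⟨⋂ N, ⋂ j, Subtype.val ⁻¹' (QuotientGroup.mk '' U N j), ?_, ?_, ?_⟩
  · exact .iInter fun N => .iInter fun j =>
      ((autGroup.isOpen_image_mk (hU N j)).preimage continuous_subtype_val).isGδ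
  · rw [Subtype.dense_iff]
    refine closure_minimal ?_ isClosed_closure
    rintro _ ⟨n, rfl⟩
    refine mem_closure_of_tendsto
      ((continuous_quot_mk.tendsto _).comp (tendsto_shiftAut_zpow_add_length ha hab n)) ?_
    -- As `n + |B_k|` is eventually positive, only positive powers are needed.
    filter_upwards [eventually_lt_length ha hab n.natAbs] with k hk
    obtain ⟨m, hm⟩ := Int.eq_ofNat_of_zero_le
      (show (0 : ℤ) ≤ ((block a b k).length : ℤ) + n by omega)
    refine ⟨⟨genMap ha hab ^ (((block a b k).length : ℤ) + n), subset_closure ⟨_, rfl⟩⟩, ?_, rfl⟩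
    simp only [mem_iInter, mem_preimage, hpow]
    intro N j
    refine ⟨_, ?_, rfl⟩
    rw [hm]
    exact shiftAut_pow_mem_approxTower ha hab (by omega) N (by simp)
  · intro S hS
    obtain ⟨e, he⟩ := QuotientGroup.mk_surjective (S : Aut (measure ha hab))
    refine ⟨e, he, isRankOne_of_mem_approxTower (fun N => measurable_window a b N)
      (fun n P hP ε hε => exists_window_approx _ hP hε) fun N j => ?_⟩
    -- Any representative will do, because an open set contains whole classes.
    refine autGroup.mem_of_mk_mem_image (hU N j) ?_
    rw [he]
    exact mem_iInter.1 (mem_iInter.1 hS N) j
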